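/- Let $(R,\mathfrak m)$ be a Noetherian local ring of prime characteristic $p>0$, and for an ideal $I$ and $q=p^e$ let $I^{[q]}$ denote the ideal generated by the $q$-th powers of the elements of $I$. For a Noetherian local ring $(A,\mathfrak n)$ of characteristic $p$, its normalized Hilbert–Kunz function is $$q=p^e\ \longmapsto\ \frac{1}{q^{\dim A}}\,\mathrm{length}_A\bigl(A/\mathfrak n^{[q]}\bigr),\qquad e=0,1,2,\dots$$ Let $\mathfrak p$ be a prime ideal of $R$ such that $R/\mathfrak p$ is a regular local ring and $\operatorname{ht}\mathfrak p+\dim R/\mathfrak p=\dim R$. Then: 1. For each fixed $q=p^e$, the normalized Hilbert–Kunz functions of $R$ and of $R_{\mathfrak p}$ take the same value at $q$, that is, $$\frac{1}{q^{\dim R}}\,\mathrm{length}_R\bigl(R/\mathfrak m^{[q]}\bigr)=\frac{1}{q^{\dim R_{\mathfrak p}}}\,\mathrm{length}_{R_{\mathfrak p}}\bigl(R_{\mathfrak p}/(\mathfrak pR_{\mathfrak p})^{[q]}\bigr),$$ if and only if the ring $R/\mathfrak p^{[q]}$ is Cohen–Macaulay. 2. Consequently, the normalized Hilbert–Kunz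 functions of $R$ and $R_{\mathfrak p}$ coincide for all $q$ if and only if $R/\mathfrak p^{[q]}$ is Cohen–Macaulay for all $q$. -/

import Mathlib

noncomputable section

/-- The Frobenius (bracket) power `I^{[q]}`: the ideal generated by the `q`-th powers of the
elements of `I`. -/
def Ideal.bracketPower {A : Type*} [CommRing A] (I : Ideal A) (q : ℕ) : Ideal A :=
  Ideal.span ((fun x : A => x ^ q) '' (I : Set A))

/-- The normalized Hilbert-Kunz function
`q ↦ length_A (A / 𝔪^{[q]}) / q ^ dim A` of a local ring `(A, 𝔪)`.
It is meant for Noetherian `A` and `q ≥ 1`; then the length and the dimension are finite,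
and the conversions to natural numbers lose nothing. -/
def hilbertKunzFunction (A : Type*) [CommRing A] [IsLocalRing A] (q : ℕ) : ℝ :=
  ((Module.length A (A ⧸ (IsLocalRing.maximalIdeal A).bracketPower q)).toNat : ℝ) /
    (q : ℝ) ^ ((ringKrullDim A).unbotD 0).toNat

/-- The depth of a local ring: the supremum of the lengths of the regular sequences
contained in its maximal ideal. -/
def localRingDepth (A : Type*) [CommRing A] [IsLocalRing A] : ℕ∞ :=
  ⨆ rs ∈ {rs : List A | RingTheory.Sequence.IsRegular A rs ∧
    ∀ r ∈ rs, r ∈ IsLocalRing.maximalIdeal A}, (rs.length : ℕ∞)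

/-- A Cohen-Macaulay local ring: a Noetherian local ring whose depth equals its Krull dimension. -/
class IsCohenMacaulayLocalRing (A : Type*) [CommRing A] : Prop extends
    IsLocalRing A, IsNoetherianRing A where
  depth_eq_ringKrullDim : (localRingDepth A : WithBot ℕ∞) = ringKrullDim A

end

open IsLocalRing RingTheory.Sequence Function
open scoped Pointwise

/-! Let d = dim R/P and M = R/P^[q]. Since R/P is regular, there are x_1, …, x_d with P + (x_1, …,
x_d) = 𝔪, hence 𝔪^[q] = P^[q] + (x_1^q, …, x_d^q). Write ℓ_P for the length of the localization at
P. As ht P + d = dim R, clearing powers of q turns the equality of Hilbert–Kunz values into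
length(M/(x_1^q, …, x_d^q)M) = q^d · ℓ_P(M).

The ideals P + (x_1, …, x_i) form a strict chain of primes (`primeChain_of_le_ringKrullDim`). One
step of it, from P to P' = P + (x), obeys ℓ_{P'}(M/x^q M) = q · ℓ_P(M) + ℓ_{P'}(ker of x^q on M)
(`localLength_quotSMulTop`), by dévissage and additivity of the Euler characteristic of
multiplication by x^q. Iteration gives "≥" in the equation above, with equality exactly when the
x_i^q form a weakly regular sequence on M (`length_quotient_ofList_smul_top`). The delicate point is
that the error terms see the kernels only after localization; Nakayama's lemma recovers the kernels
themselves.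

Finally the x_i^q are a system of parameters of R/P^[q], and regularity of one system of parameters
implies that of any other (`isWeaklyRegular_quotient_of_isWeaklyRegular`), so this regularity is
Cohen–Macaulayness. -/

/-- The length over `R_P` of the localization at `P` of an `R`-module. -/
noncomputable def localLength {R : Type*} [CommRing R] (P : Ideal R) [P.IsPrime] (M : Type*)
    [AddCommGroup M] [Module R M] : ℕ∞ :=
  Module.length (Localization.AtPrime P) (LocalizedModule P.primeCompl M)

/-! ### Length of the localization at a prime, and its additivity -/

section localLength

variable {R : Type*} [CommRing R] (P : Ideal R) [P.IsPrime]
  {M N L : Type*} [AddCommGroup M] [Module R M] [AddCommGroup N] [Module R N]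
  [AddCommGroup L] [Module R L]

lemma localLength_eq_add_of_exact {f : M →ₗ[R] N} {g : N →ₗ[R] L} (hf : Injective f)
    (hg : Surjective g) (h : Exact f g) :
    localLength P N = localLength P M + localLength P L :=
  Module.length_eq_add_of_exact (LocalizedModule.map P.primeCompl f)
    (LocalizedModule.map P.primeCompl g) (LocalizedModule.map_injective _ _ hf)
    (LocalizedModule.map_surjective _ _ hg) (LocalizedModule.map_exact _ _ _ h)

lemma localLength_eq_zero_iff :
    localLength P M = 0 ↔ ∀ m : M, ∃ s ∉ P, s • m = 0 := by
  rw [localLength, Module.length_eq_zero_iff, LocalizedModule.subsingleton_iff]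
  rfl

lemma localLength_eq_zero_of_forall {s : R} (hs : s ∉ P) (h : ∀ m : M, s • m = 0) :
    localLength P M = 0 :=
  (localLength_eq_zero_iff P).2 fun m ↦ ⟨s, hs, h m⟩

lemma localLength_of_subsingleton [Subsingleton M] : localLength P M = 0 :=
  (localLength_eq_zero_iff P).2 fun m ↦
    ⟨1, (Ideal.ne_top_iff_one P).1 (Ideal.IsPrime.ne_top ‹_›), Subsingleton.elim _ _⟩

lemma localLength_congr (e : M ≃ₗ[R] N) : localLength P M = localLength P N := by
  -- Invariance under isomorphism is additivity along 0 → M → N → 0.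
  have := localLength_eq_add_of_exact P (f := e.toLinearMap) (g := (0 : N →ₗ[R] PUnit))
    e.injective (surjective_to_subsingleton _)
    ((e.toLinearMap.exact_zero_iff_surjective _).2 e.surjective)
  rw [this, localLength_of_subsingleton P (M := PUnit), add_zero]

lemma localLength_ker_add_range (f : M →ₗ[R] N) :
    localLength P M = localLength P f.ker + localLength P f.range :=
  localLength_eq_add_of_exact P (f := f.ker.subtype) (g := f.rangeRestrict)
    (Submodule.injective_subtype _) f.surjective_rangeRestrict (by
      rw [LinearMap.exact_iff]; simp)

lemma localLength_eq_range_add_range {f : M →ₗ[R] N} {g : N →ₗ[R] L} (h : Exact f g) :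
    localLength P N = localLength P f.range + localLength P g.range := by
  rw [localLength_ker_add_range P g, LinearMap.exact_iff.1 h]

lemma localLength_range_of_injective {f : M →ₗ[R] N} (hf : Injective f) :
    localLength P f.range = localLength P M :=
  (localLength_congr P (LinearEquiv.ofInjective f hf)).symm

lemma localLength_range_of_surjective {f : M →ₗ[R] N} (hf : Surjective f) :
    localLength P f.range = localLength P N := by
  rw [LinearMap.range_eq_top.2 hf]
  exact localLength_congr P Submodule.topEquiv

lemma localLength_quotient (I : Ideal R) :
    localLength P (R ⧸ I) = Module.length (Localization.AtPrime P)
      (Localization.AtPrime P ⧸ I.map (algebraMap R (Localization.AtPrime P))) := by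
  let f := Submodule.toLocalizedQuotient' (Localization.AtPrime P) P.primeCompl
    (Algebra.linearMap R (Localization.AtPrime P)) I
  let e := (IsLocalizedModule.iso P.primeCompl f).extendScalarsOfIsLocalization P.primeCompl
    (Localization.AtPrime P)
  rw [localLength, e.length_eq]
  exact (Submodule.quotEquivOfEq _ _ (Ideal.localized'_eq_map _ _ _)).length_eq

lemma localLength_quotient_self : localLength P (R ⧸ P) = 1 := by
  rw [localLength_quotient, Localization.AtPrime.map_eq_maximalIdeal, Module.length_eq_one_iff]
  exact isSimpleModule_iff_isCoatom.2 (maximalIdeal.isMaximal _).1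

lemma localLength_maximalIdeal {R : Type*} [CommRing R] [IsLocalRing R] {M : Type*}
    [AddCommGroup M] [Module R M] :
    localLength (maximalIdeal R) M = Module.length R M := by
  have hu : ∀ x : (maximalIdeal R).primeCompl, IsUnit (x : R) := fun x ↦ by
    by_contra h
    exact x.2 h
  have : IsLocalization (maximalIdeal R).primeCompl R :=
    IsLocalization.self fun x hx ↦ hu ⟨x, hx⟩
  have := isLocalizedModule_id (maximalIdeal R).primeCompl M R
  have e := IsLocalizedModule.iso (maximalIdeal R).primeCompl (LinearMap.id : M →ₗ[R] M)
  rw [← e.length_eq, localLength, ← Module.length_eq_of_surjective (S := R)]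
  exact (IsLocalization.atUnits R (maximalIdeal R).primeCompl fun x hx ↦ hu ⟨x, hx⟩).surjective

end localLength

/-! ### Additivity of the Euler characteristic of multiplication by a -/

section snake

variable {R : Type*} [CommRing R] (P : Ideal R) [P.IsPrime]
  {M N L : Type*} [AddCommGroup M] [Module R M] [AddCommGroup N] [Module R N]
  [AddCommGroup L] [Module R L]

lemma exact_lsmul_mkQ (a : R) :
    Exact (LinearMap.lsmul R M a) (a • (⊤ : Submodule R M)).mkQ := by
  rw [LinearMap.exact_iff, Submodule.ker_mkQ]
  ext x
  simp [Submodule.mem_smul_pointwise_iff_exists]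

/-- Alternating sum of lengths along the six-term snake sequence. Negative terms are moved to the
other side, as `ℕ∞` has no usable subtraction. -/
lemma localLength_snake {f : M →ₗ[R] N} {g : N →ₗ[R] L} (hf : Injective f)
    (hg : Surjective g) (h : Exact f g) (a : R) :
    localLength P (QuotSMulTop a N) + localLength P (LinearMap.lsmul R M a).ker +
        localLength P (LinearMap.lsmul R L a).ker =
      localLength P (LinearMap.lsmul R N a).ker + localLength P (QuotSMulTop a M) +
        localLength P (QuotSMulTop a L) := by
  let i₁ := LinearMap.lsmul R M a
  let i₂ := LinearMap.lsmul R N a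
  let i₃ := LinearMap.lsmul R L a
  have h₁ : f.comp i₁ = i₂.comp f := by ext; simp [i₁, i₂]
  have h₂ : g.comp i₂ = i₃.comp g := by ext; simp [i₃, i₂]
  let F : i₁.ker →ₗ[R] i₂.ker := f.restrict fun x hx ↦ by
    rw [LinearMap.mem_ker] at hx ⊢
    rw [← LinearMap.comp_apply, ← h₁, LinearMap.comp_apply, hx, map_zero]
  let G : i₂.ker →ₗ[R] i₃.ker := g.restrict fun x hx ↦ by
    rw [LinearMap.mem_ker] at hx ⊢
    rw [← LinearMap.comp_apply, ← h₂, LinearMap.comp_apply, hx, map_zero]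
  have hF : Injective F := fun x y hxy ↦ Subtype.ext (hf (congrArg Subtype.val hxy))
  have hFG : Exact F G := by
    intro y
    constructor
    · intro hy
      obtain ⟨x, hx⟩ := (h y).1 (congrArg Subtype.val hy)
      refine ⟨⟨x, hf ?_⟩, Subtype.ext hx⟩
      rw [← LinearMap.comp_apply, h₁, LinearMap.comp_apply, hx, map_zero]
      exact y.2
    · rintro ⟨x, rfl⟩
      exact Subtype.ext (h.apply_apply_eq_zero x)
  have hι₂ := LinearMap.exact_subtype_ker_map i₂
  have hι₃ := LinearMap.exact_subtype_ker_map i₃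
  have hπ₁ := exact_lsmul_mkQ a (M := M)
  have hπ₂ := exact_lsmul_mkQ a (M := N)
  let δ := SnakeLemma.δ' i₁ i₂ i₃ f g h f g h h₁ h₂ i₃.ker.subtype hι₃
    (a • (⊤ : Submodule R M)).mkQ hπ₁ hg hf
  have hGδ : Exact G δ := SnakeLemma.exact_δ'_right i₁ i₂ i₃ f g h f g h h₁ h₂
    i₂.ker.subtype hι₂ i₃.ker.subtype hι₃ _ hπ₁ hg hf G rfl (Submodule.injective_subtype _)
  have hδ : Exact δ (QuotSMulTop.map a f) := SnakeLemma.exact_δ'_left i₁ i₂ i₃ f g h f g h h₁ h₂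
    i₃.ker.subtype hι₃ _ hπ₁ _ hπ₂ hg hf (QuotSMulTop.map a f) rfl (Submodule.mkQ_surjective _)
  have hC := QuotSMulTop.map_exact a h hg
  rw [localLength_eq_range_add_range P hFG, localLength_eq_range_add_range P hGδ,
    localLength_eq_range_add_range P hδ, localLength_eq_range_add_range P hC,
    localLength_range_of_injective P hF,
    localLength_range_of_surjective P (QuotSMulTop.map_surjective a hg)]
  ring
end snake

/-! ### The one-step length formula -/

section oneDim

variable {R : Type*} [CommRing R]

/-- `(R / I) / J (R / I)` is `R / (I + J)`. -/
noncomputable def quotSMulTopQuotientEquivSup (I J : Ideal R) :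
    ((R ⧸ I) ⧸ (J • ⊤ : Submodule R (R ⧸ I))) ≃ₗ[R] R ⧸ (I ⊔ J) :=
  Submodule.quotEquivOfEq (J • ⊤) (Submodule.map I.mkQ J) (by
    rw [← I.range_mkQ, ← Submodule.map_top, ← Submodule.map_smul'', smul_eq_mul, Ideal.mul_top]) ≪≫ₗ
    Submodule.quotientQuotientEquivQuotientSup I J

/-- `(R / I) / x (R / I)` is `R / (I + (x))`. -/
noncomputable def quotSMulTopQuotientEquiv (I : Ideal R) (x : R) :
    QuotSMulTop x (R ⧸ I) ≃ₗ[R] R ⧸ (I ⊔ Ideal.span {x}) :=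
  Submodule.quotEquivOfEq (x • ⊤) (Ideal.span {x} • ⊤)
    (Submodule.ideal_span_singleton_smul _ _).symm ≪≫ₗ
    quotSMulTopQuotientEquivSup I (Ideal.span {x})

lemma le_radical_annihilator_quotSMulTop {P : Ideal R} {M : Type*} [AddCommGroup M] [Module R M]
    (h : P ≤ (Module.annihilator R M).radical) (x : R) (q : ℕ) :
    P ⊔ Ideal.span {x} ≤ (Module.annihilator R (QuotSMulTop (x ^ q) M)).radical := by
  refine sup_le (h.trans (Ideal.radical_mono
    (LinearMap.annihilator_le_of_surjective _ (Submodule.mkQ_surjective _)))) ?_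
  rw [Ideal.span_singleton_le_iff_mem]
  refine ⟨q, Module.mem_annihilator.2 fun m ↦ ?_⟩
  obtain ⟨m, rfl⟩ := Submodule.mkQ_surjective _ m
  rw [← map_smul, Submodule.mkQ_apply, Submodule.Quotient.mk_eq_zero]
  exact Submodule.smul_mem_pointwise_smul _ _ _ trivial

lemma le_radical_annihilator_ker {P : Ideal R} {M : Type*} [AddCommGroup M] [Module R M]
    (h : P ≤ (Module.annihilator R M).radical) (x : R) (q : ℕ) :
    P ⊔ Ideal.span {x} ≤
      (Module.annihilator R (LinearMap.lsmul R M (x ^ q)).ker).radical := by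
  refine sup_le (h.trans (Ideal.radical_mono
    (LinearMap.annihilator_le_of_injective _ (Submodule.injective_subtype _)))) ?_
  rw [Ideal.span_singleton_le_iff_mem]
  exact ⟨q, Module.mem_annihilator.2 fun m ↦ Subtype.ext m.2⟩

lemma le_of_le_radical_annihilator {P : Ideal R} {M : Type*} [AddCommGroup M] [Module R M]
    (h : P ≤ (Module.annihilator R M).radical) {Q : Ideal R} [hQ : Q.IsPrime]
    (e : M ≃ₗ[R] R ⧸ Q) : P ≤ Q := by
  rwa [e.annihilator_eq, Ideal.annihilator_quotient, hQ.radical] at h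

lemma span_singleton_le_jacobson_bot [IsLocalRing R] {x : R} (hx : x ∈ maximalIdeal R) :
    Ideal.span {x} ≤ Ideal.jacobson ⊥ := by
  rwa [IsLocalRing.jacobson_eq_maximalIdeal _ bot_ne_top, Ideal.span_singleton_le_iff_mem]

variable [IsNoetherianRing R]

/-- If b + cx ∈ Q with b ∈ P ≤ Q, then cx ∈ Q, so c ∈ Q. Thus Q ≤ P + xQ, and Nakayama applies. -/
lemma le_of_le_sup_span_singleton [IsLocalRing R] {P Q : Ideal R} [hQ : Q.IsPrime] (hPQ : P ≤ Q)
    {x : R} (hx : x ∈ maximalIdeal R) (hxQ : x ∉ Q) (hle : Q ≤ P ⊔ Ideal.span {x}) : Q ≤ P := by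
  refine Submodule.le_of_le_smul_of_le_jacobson_bot (IsNoetherian.noetherian Q)
    (span_singleton_le_jacobson_bot hx) fun a ha ↦ ?_
  obtain ⟨b, hb, c, hc, rfl⟩ := Submodule.mem_sup.1 (hle ha)
  obtain ⟨c, rfl⟩ := Ideal.mem_span_singleton'.1 hc
  refine Submodule.add_mem_sup hb ?_
  have hcx : c * x ∈ Q := (Ideal.add_mem_iff_right _ (hPQ hb)).1 ha
  rw [mul_comm c x]
  exact Submodule.smul_mem_smul (Ideal.mem_span_singleton_self x)
    ((hQ.mem_or_mem hcx).resolve_right hxQ)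

/-- By dévissage to R/Q with P ≤ Q: the local length is 1 if Q = P and 0 otherwise. -/
lemma localLength_ne_top (P : Ideal R) [P.IsPrime] {M : Type*} [AddCommGroup M] [Module R M]
    [hM : Module.Finite R M] (h : P ≤ (Module.annihilator R M).radical) :
    localLength P M ≠ ⊤ := by
  induction hM using IsNoetherianRing.induction_on_isQuotientEquivQuotientPrime R with
  | subsingleton N => simp [localLength_of_subsingleton]
  | quotient N Q e =>
    by_cases hQP : Q.1 ≤ P
    · obtain rfl : P = Q.1 := le_antisymm (le_of_le_radical_annihilator h e) hQP
      rw [localLength_congr _ e, localLength_quotient_self]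
      simp
    · obtain ⟨s, hs, hsP⟩ := SetLike.not_le_iff_exists.1 hQP
      rw [localLength_eq_zero_of_forall P hsP fun m ↦ e.injective ?_]
      · simp
      · rw [map_smul, map_zero]
        exact Module.mem_annihilator.1 ((Ideal.annihilator_quotient (I := Q.1)).symm ▸ hs) (e m)
  | exact N₁ N₂ N₃ f g hf hg hfg h₁ h₃ =>
    rw [localLength_eq_add_of_exact P hf hg hfg]
    exact WithTop.add_ne_top.2
      ⟨h₁ (h.trans (Ideal.radical_mono (LinearMap.annihilator_le_of_injective f hf))),
        h₃ (h.trans (Ideal.radical_mono (LinearMap.annihilator_le_of_surjective g hg)))⟩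

omit [IsNoetherianRing R] in
lemma localLength_quotSMulTop_pow (P : Ideal R) [P.IsPrime] {M : Type*} [AddCommGroup M]
    [Module R M] {x : R} (hx : IsSMulRegular M x) (q : ℕ) :
    localLength P (QuotSMulTop (x ^ q) M) = q * localLength P (QuotSMulTop x M) := by
  induction q with
  | zero =>
    have : Subsingleton (QuotSMulTop (x ^ 0) M) := by
      rw [Submodule.Quotient.subsingleton_iff]
      simp
    simp [localLength_of_subsingleton]
  | succ q ih =>
    -- Induct along 0 → M/x^q M → M/x^(q+1) M → M/xM → 0, the first map being multiplication by x.
    let f : QuotSMulTop (x ^ q) M →ₗ[R] QuotSMulTop (x ^ (q + 1)) M :=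
      Submodule.mapQ _ _ (LinearMap.lsmul R M x) (by
        rintro _ ⟨m, -, rfl⟩
        refine ⟨m, trivial, ?_⟩
        simp [pow_succ', mul_smul, smul_comm x])
    let g : QuotSMulTop (x ^ (q + 1)) M →ₗ[R] QuotSMulTop x M :=
      Submodule.mapQ _ _ LinearMap.id (by
        rintro _ ⟨m, -, rfl⟩
        refine ⟨x ^ q • m, trivial, ?_⟩
        simp [pow_succ', mul_smul, smul_comm x])
    have hf : Injective f := by
      rw [injective_iff_map_eq_zero]
      intro m hm
      obtain ⟨m, rfl⟩ := Submodule.mkQ_surjective _ m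
      obtain ⟨m', -, hm'⟩ := (Submodule.Quotient.mk_eq_zero _).1 hm
      refine (Submodule.Quotient.mk_eq_zero _).2 ⟨m', trivial, hx ?_⟩
      simpa [pow_succ', mul_smul] using hm'
    have hg : Surjective g := fun m ↦ by
      obtain ⟨m, rfl⟩ := Submodule.mkQ_surjective _ m
      exact ⟨Submodule.Quotient.mk m, rfl⟩
    have hfg : Exact f g := fun m ↦ by
      obtain ⟨m, rfl⟩ := Submodule.mkQ_surjective _ m
      constructor
      · intro hm
        obtain ⟨m', -, hm'⟩ := (Submodule.Quotient.mk_eq_zero _).1 hm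
        exact ⟨Submodule.Quotient.mk m', congrArg Submodule.Quotient.mk hm'⟩
      · rintro ⟨m', hm'⟩
        obtain ⟨m', rfl⟩ := Submodule.mkQ_surjective _ m'
        rw [← hm']
        exact (Submodule.Quotient.mk_eq_zero _).2 ⟨m', trivial, rfl⟩
    rw [localLength_eq_add_of_exact P hf hg hfg, ih]
    push_cast
    ring

/-- Both sides are additive once the kernel term is moved to the left, so M = R/Q with P ≤ Q
suffices. For Q = P, x is regular and both sides are q. For Q ≠ P, ℓ_P vanishes; then either x ∈ Q
and x^q acts as zero, or Q is not contained in P' and everything dies at P'. -/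
lemma localLength_quotSMulTop [IsLocalRing R] {P P' : Ideal R} [P.IsPrime] [P'.IsPrime] {x : R}
    (hP' : P ⊔ Ideal.span {x} = P') (hxP : x ∉ P) {q : ℕ} (hq : q ≠ 0) {M : Type*}
    [AddCommGroup M] [Module R M] [hM : Module.Finite R M]
    (h : P ≤ (Module.annihilator R M).radical) :
    localLength P' (QuotSMulTop (x ^ q) M) =
      q * localLength P M + localLength P' (LinearMap.lsmul R M (x ^ q)).ker := by
  induction hM using IsNoetherianRing.induction_on_isQuotientEquivQuotientPrime R with
  | subsingleton N => simp [localLength_of_subsingleton]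
  | quotient N Q e =>
    have hPQ := le_of_le_radical_annihilator h e
    have hann {s : R} (hs : s ∈ Q.1) (m : N) : s • m = 0 := e.injective <| by
      rw [map_smul, map_zero]
      exact Module.mem_annihilator.1 ((Ideal.annihilator_quotient (I := Q.1)).symm ▸ hs) (e m)
    by_cases hQP : Q.1 ≤ P
    · obtain rfl : P = Q.1 := le_antisymm hPQ hQP
      have hx : IsSMulRegular N x := by
        rw [e.isSMulRegular_congr]
        intro a b hab
        obtain ⟨a, rfl⟩ := Ideal.Quotient.mk_surjective a
        obtain ⟨b, rfl⟩ := Ideal.Quotient.mk_surjective b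
        refine Ideal.Quotient.eq.2 ((Q.2.mem_or_mem ?_).resolve_left hxP)
        rw [mul_sub]
        exact Ideal.Quotient.eq.1 hab
      have hker : (LinearMap.lsmul R N (x ^ q)).ker = ⊥ := LinearMap.ker_eq_bot.2 (hx.pow q)
      have : Subsingleton (LinearMap.lsmul R N (x ^ q)).ker := by
        rw [hker]; infer_instance
      rw [localLength_quotSMulTop_pow P' hx, localLength_of_subsingleton P' (M := LinearMap.ker _),
        localLength_congr Q.1 e, localLength_quotient_self,
        localLength_congr P' (QuotSMulTop.congr x e ≪≫ₗ quotSMulTopQuotientEquiv Q.1 x),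
        hP', localLength_quotient_self, add_zero]
    · obtain ⟨s, hs, hsP⟩ := SetLike.not_le_iff_exists.1 hQP
      rw [localLength_eq_zero_of_forall P hsP (hann hs), mul_zero, zero_add]
      by_cases hxQ : x ∈ Q.1
      · have hx := hann (Ideal.pow_mem_of_mem Q.1 hxQ q (Nat.pos_of_ne_zero hq))
        have h₁ : (LinearMap.lsmul R N (x ^ q)).ker = ⊤ := by
          rw [eq_top_iff]; exact fun m _ ↦ hx m
        have h₂ : x ^ q • (⊤ : Submodule R N) = ⊥ := by
          rw [eq_bot_iff]
          rintro _ ⟨m, -, rfl⟩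
          exact hx m
        rw [localLength_congr P' (Submodule.quotEquivOfEqBot _ h₂), h₁,
          localLength_congr P' Submodule.topEquiv]
      · have hQP' : ¬ Q.1 ≤ P' := fun hle ↦ hQP <| by
          have hxm : x ∈ maximalIdeal R := by
            refine le_maximalIdeal (Ideal.IsPrime.ne_top ‹P'.IsPrime›) ?_
            rw [← hP']
            exact Ideal.mem_sup_right (Ideal.mem_span_singleton_self x)
          exact le_of_le_sup_span_singleton hPQ hxm hxQ (hP' ▸ hle)
        obtain ⟨t, ht, htP'⟩ := SetLike.not_le_iff_exists.1 hQP'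
        rw [localLength_eq_zero_of_forall P' htP', localLength_eq_zero_of_forall P' htP']
        · exact fun m ↦ Subtype.ext (hann ht _)
        · intro m
          obtain ⟨m, rfl⟩ := Submodule.mkQ_surjective _ m
          rw [← map_smul, hann ht, map_zero]
  | exact N₁ N₂ N₃ f g hf hg hfg h₁ h₃ =>
    have hN₁ := h.trans (Ideal.radical_mono (LinearMap.annihilator_le_of_injective f hf))
    have hN₃ := h.trans (Ideal.radical_mono (LinearMap.annihilator_le_of_surjective g hg))
    have hs := localLength_snake P' hf hg hfg (x ^ q)
    rw [h₁ hN₁, h₃ hN₃] at hs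
    have hk₁ : localLength P' (LinearMap.lsmul R N₁ (x ^ q)).ker ≠ ⊤ :=
      localLength_ne_top P' (hP' ▸ le_radical_annihilator_ker hN₁ x q)
    have hk₃ : localLength P' (LinearMap.lsmul R N₃ (x ^ q)).ker ≠ ⊤ :=
      localLength_ne_top P' (hP' ▸ le_radical_annihilator_ker hN₃ x q)
    have hk : localLength P' (LinearMap.lsmul R N₁ (x ^ q)).ker +
        localLength P' (LinearMap.lsmul R N₃ (x ^ q)).ker ≠ ⊤ := by simp [hk₁, hk₃]
    rw [localLength_eq_add_of_exact P hf hg hfg]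
    -- Cancelling the kernel terms of N₁ and N₃ is legitimate because they have finite local length.
    refine ENat.add_left_injective_of_ne_top hk ?_
    beta_reduce
    rw [← add_assoc, hs]
    ring

end oneDim

/-! ### Iteration along a chain of primes -/

section primeChain

variable {R : Type*} [CommRing R] [IsLocalRing R]

/-- `I ⊂ I + (x₁) ⊂ I + (x₁, x₂) ⊂ ⋯` is a strictly increasing chain of prime ideals that ends
with the maximal ideal. -/
def PrimeChain : Ideal R → List R → Prop
  | I, [] => I = maximalIdeal R
  | I, x :: xs => I.IsPrime ∧ x ∉ I ∧ PrimeChain (I ⊔ Ideal.span {x}) xs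

lemma PrimeChain.isPrime : ∀ {I : Ideal R} {xs : List R}, PrimeChain I xs → I.IsPrime
  | _, [], h => h ▸ (maximalIdeal.isMaximal R).isPrime
  | _, _ :: _, h => h.1

lemma PrimeChain.mem_maximalIdeal {I : Ideal R} {x : R} {xs : List R}
    (h : PrimeChain I (x :: xs)) : x ∈ maximalIdeal R :=
  le_maximalIdeal h.2.2.isPrime.ne_top
    (Ideal.mem_sup_right (Ideal.mem_span_singleton_self x))

variable [IsNoetherianRing R]

/-- An unmixedness statement: zero divisors on M lie in P. For K the kernel of s, the one-step
formula gives ℓ_{P'}(K/x^q K) = 0; induction applied to M/x^q M then yields K ≤ x^q M, hence K = x^q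
K, and Nakayama kills K. -/
lemma eq_zero_of_smul_eq_zero_of_isWeaklyRegular {q : ℕ} (hq : q ≠ 0) {xs : List R} :
    ∀ {P : Ideal R} {M : Type*} [AddCommGroup M] [Module R M] [Module.Finite R M],
      PrimeChain P xs → P ≤ (Module.annihilator R M).radical →
      IsWeaklyRegular M (xs.map (· ^ q)) → ∀ {s : R} {m : M}, s ∉ P → s • m = 0 → m = 0 := by
  induction xs with
  | nil =>
    intro P M _ _ _ hP _ _ s m hs hsm
    have hs : IsUnit s := by
      by_contra h
      exact hs (hP ▸ h)
    exact hs.smul_eq_zero.1 hsm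
  | cons x xs ih =>
    intro P M _ _ _ hP hM hreg s m hs hsm
    have := hP.isPrime
    have := hP.2.2.isPrime
    rw [List.map_cons, isWeaklyRegular_cons_iff] at hreg
    let K := (LinearMap.lsmul R M s).ker
    have hK : P ≤ (Module.annihilator R K).radical := hM.trans (Ideal.radical_mono
      (LinearMap.annihilator_le_of_injective _ (Submodule.injective_subtype _)))
    have hK₀ : localLength P K = 0 :=
      localLength_eq_zero_of_forall P hs fun m ↦ Subtype.ext m.2
    have : Subsingleton (LinearMap.lsmul R K (x ^ q)).ker :=
      (Submodule.subsingleton_iff_eq_bot).2 <| LinearMap.ker_eq_bot.2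
        (hreg.1.submodule K _)
    have hl := localLength_quotSMulTop rfl hP.2.1 hq hK
    rw [hK₀, mul_zero, zero_add, localLength_of_subsingleton _ (M := LinearMap.ker _),
      localLength_eq_zero_iff] at hl
    have hle : K ≤ ⊥ ⊔ Ideal.span {x} • K := by
      intro k hk
      obtain ⟨t, ht, htk⟩ := hl (Submodule.Quotient.mk ⟨k, hk⟩)
      obtain ⟨k', -, hk'⟩ := (Submodule.Quotient.mk_eq_zero _).1 htk
      have hk₀ := ih hP.2.2 (le_radical_annihilator_quotSMulTop hM x q) hreg.2
        (m := Submodule.Quotient.mk k) ht ((Submodule.Quotient.mk_eq_zero _).2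
          ⟨k', trivial, congrArg Subtype.val hk'⟩)
      obtain ⟨m', -, rfl⟩ := (Submodule.Quotient.mk_eq_zero _).1 hk₀
      have hm' : m' ∈ K := hreg.1 <| by
        change x ^ q • s • m' = x ^ q • 0
        rw [smul_comm, smul_zero]
        exact hk
      refine Submodule.mem_sup_right (Submodule.smul_mem_smul ?_ hm')
      exact Ideal.pow_mem_of_mem _ (Ideal.mem_span_singleton_self x) q (Nat.pos_of_ne_zero hq)
    exact Submodule.le_of_le_smul_of_le_jacobson_bot (IsNoetherian.noetherian K)
      (span_singleton_le_jacobson_bot hP.mem_maximalIdeal) hle hsm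

/-- The kernel of x^q lies in the kernel T of M → M_{P'}. Unmixedness of M/x^q M gives T ≤ x^q M,
and the vanishing of the localized kernel puts the quotients by x^q back in T; so T = xT and T = 0.
-/
lemma isSMulRegular_of_localLength_ker_eq_zero {q : ℕ} (hq : q ≠ 0) {P : Ideal R} {x : R}
    {xs : List R} {M : Type*} [AddCommGroup M] [Module R M] [Module.Finite R M]
    (hP : PrimeChain P (x :: xs)) [(P ⊔ Ideal.span {x}).IsPrime]
    (hM : P ≤ (Module.annihilator R M).radical)
    (hreg : IsWeaklyRegular (QuotSMulTop (x ^ q) M) (xs.map (· ^ q)))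
    (hker : localLength (P ⊔ Ideal.span {x}) (LinearMap.lsmul R M (x ^ q)).ker = 0) :
    IsSMulRegular M (x ^ q) := by
  let S := (P ⊔ Ideal.span {x}).primeCompl
  let T := (LocalizedModule.mkLinearMap S M).ker
  have hT {m : M} : m ∈ T ↔ ∃ s ∈ S, s • m = 0 := LocalizedModule.mem_ker_mkLinearMap_iff
  rw [localLength_eq_zero_iff] at hker
  have hle : T ≤ ⊥ ⊔ Ideal.span {x} • T := by
    intro m hm
    obtain ⟨t, ht, htm⟩ := hT.1 hm
    have hm₀ := eq_zero_of_smul_eq_zero_of_isWeaklyRegular hq hP.2.2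
      (le_radical_annihilator_quotSMulTop hM x q) hreg
      (m := Submodule.Quotient.mk m) ht (by rw [← Submodule.Quotient.mk_smul, htm]; rfl)
    obtain ⟨m', -, rfl⟩ := (Submodule.Quotient.mk_eq_zero _).1 hm₀
    obtain ⟨s, hs, hsm⟩ := hker ⟨t • m', by
      change x ^ q • t • m' = 0
      rw [smul_comm]
      exact htm⟩
    have hm' : m' ∈ T := hT.2 ⟨s * t, S.mul_mem hs ht, by
      rw [mul_smul]
      exact congrArg Subtype.val hsm⟩
    refine Submodule.mem_sup_right (Submodule.smul_mem_smul ?_ hm')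
    exact Ideal.pow_mem_of_mem _ (Ideal.mem_span_singleton_self x) q (Nat.pos_of_ne_zero hq)
  have hT₀ := Submodule.le_of_le_smul_of_le_jacobson_bot (IsNoetherian.noetherian T)
    (span_singleton_le_jacobson_bot hP.mem_maximalIdeal) hle
  refine isSMulRegular_iff_right_eq_zero_of_smul.2 fun m hm ↦ ?_
  obtain ⟨s, hs, hsm⟩ := hker ⟨m, hm⟩
  exact hT₀ (hT.2 ⟨s, hs, congrArg Subtype.val hsm⟩)

theorem length_quotient_ofList_smul_top {q : ℕ} (hq : q ≠ 0) {xs : List R} :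
    ∀ {P : Ideal R} [P.IsPrime] {M : Type*} [AddCommGroup M] [Module R M] [Module.Finite R M],
      PrimeChain P xs → P ≤ (Module.annihilator R M).radical →
      Module.length R (M ⧸ (Ideal.ofList (xs.map (· ^ q)) • ⊤ : Submodule R M)) ≠ ⊤ ∧
      q ^ xs.length * localLength P M ≤
        Module.length R (M ⧸ (Ideal.ofList (xs.map (· ^ q)) • ⊤ : Submodule R M)) ∧
      (Module.length R (M ⧸ (Ideal.ofList (xs.map (· ^ q)) • ⊤ : Submodule R M)) =
        q ^ xs.length * localLength P M ↔ IsWeaklyRegular M (xs.map (· ^ q))) := by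
  induction xs with
  | nil =>
    intro P hPP M _ _ _ hP hM
    have hlen : Module.length R
        (M ⧸ (Ideal.ofList (([] : List R).map (· ^ q)) • ⊤ : Submodule R M)) =
          localLength P M := by
      obtain rfl : P = maximalIdeal R := hP
      rw [localLength_maximalIdeal]
      exact (Submodule.quotEquivOfEqBot _ (by simp)).length_eq
    rw [hlen]
    simp [localLength_ne_top P hM]
  | cons x xs ih =>
    intro P hPP M _ _ _ hP hM
    have := hP.2.2.isPrime
    have hlen : Module.length R
        (M ⧸ (Ideal.ofList ((x :: xs).map (· ^ q)) • ⊤ : Submodule R M)) =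
        Module.length R (QuotSMulTop (x ^ q) M ⧸
          (Ideal.ofList (xs.map (· ^ q)) • ⊤ : Submodule R (QuotSMulTop (x ^ q) M))) :=
      (Submodule.quotOfListConsSMulTopEquivQuotSMulTopInner M _ _).length_eq
    obtain ⟨h₁, h₂, h₃⟩ := ih hP.2.2 (le_radical_annihilator_quotSMulTop hM x q)
    have hl := localLength_quotSMulTop rfl hP.2.1 hq hM
    have hq' : ((q : ℕ∞) ^ xs.length) ≠ 0 := by
      simp [hq]
    rw [hlen, List.map_cons, isWeaklyRegular_cons_iff, ← h₃, List.length_cons, pow_succ,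
      mul_assoc]
    rw [hl, mul_add] at h₂ h₃ ⊢
    refine ⟨h₁, le_self_add.trans h₂, fun h ↦ ?_, fun ⟨hx, h⟩ ↦ ?_⟩
    · rw [h] at h₁ h₂
      have hk : (q : ℕ∞) ^ xs.length *
          localLength (P ⊔ Ideal.span {x}) (LinearMap.lsmul R M (x ^ q)).ker = 0 := by
        -- The lower bound for M/x^q M already contains the assumed total length, which is finite,
        -- so the extra kernel term is zero.
        refine ENat.add_right_injective_of_ne_top h₁ ?_
        exact (le_antisymm h₂ le_self_add).trans (add_zero _).symm
      have hL := h.trans (by rw [hk, add_zero] :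
        _ = (q : ℕ∞) ^ xs.length * (q * localLength P M) + (q : ℕ∞) ^ xs.length *
          localLength (P ⊔ Ideal.span {x}) (LinearMap.lsmul R M (x ^ q)).ker)
      exact ⟨isSMulRegular_of_localLength_ker_eq_zero hq hP hM (h₃.1 hL)
        ((mul_eq_zero.1 hk).resolve_left hq'), hL⟩
    · have : Subsingleton (LinearMap.lsmul R M (x ^ q)).ker :=
        (Submodule.subsingleton_iff_eq_bot).2 (LinearMap.ker_eq_bot.2 hx)
      rw [h, localLength_of_subsingleton _ (M := LinearMap.ker _), mul_zero, add_zero]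

end primeChain

lemma WithBot.natCast_le_of_add_le_add {a : WithBot ℕ∞} {m n : ℕ}
    (h : ((m + n : ℕ) : WithBot ℕ∞) ≤ a + n) : (m : WithBot ℕ∞) ≤ a := by
  induction a with
  | bot => simp at h
  | coe a =>
    induction a using ENat.recTopCoe with
    | top => exact WithBot.coe_le_coe.2 le_top
    | coe a => norm_cast at h ⊢; omega

lemma WithBot.nonpos_of_add_natCast_le {a : WithBot ℕ∞} {n : ℕ} (h : a + n ≤ n) : a ≤ 0 := by
  induction a with
  | bot => simp
  | coe a =>
    induction a using ENat.recTopCoe with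
    | top =>
      exact absurd (WithBot.coe_le_coe.1 h) (by simp)
    | coe a => norm_cast at h ⊢; omega

/-! ### Krull dimension of quotients, and the chain of primes -/

section dimension

variable {R : Type*} [CommRing R]

lemma ringKrullDim_quotient_anti {I J : Ideal R} (h : I ≤ J) :
    ringKrullDim (R ⧸ J) ≤ ringKrullDim (R ⧸ I) :=
  ringKrullDim_le_of_surjective (Ideal.Quotient.factor h) (Ideal.Quotient.factor_surjective h)

lemma ringKrullDim_quotient_succ_le_of_lt {Q J : Ideal R} [Q.IsPrime] (h : Q < J) :
    ringKrullDim (R ⧸ J) + 1 ≤ ringKrullDim (R ⧸ Q) := by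
  obtain ⟨hle, a, haJ, haQ⟩ := SetLike.lt_iff_le_and_exists.1 h
  have ha : Ideal.Quotient.mk Q a ∈ nonZeroDivisors (R ⧸ Q) :=
    mem_nonZeroDivisors_of_ne_zero fun h0 ↦ haQ (Ideal.Quotient.eq_zero_iff_mem.1 h0)
  refine le_trans ?_ (ringKrullDim_quotient_succ_le_of_nonZeroDivisor ha)
  gcongr
  refine ringKrullDim_le_of_surjective (Ideal.Quotient.lift _ (Ideal.Quotient.factor hle) ?_) ?_
  · intro b hb
    obtain ⟨c, rfl⟩ := Ideal.mem_span_singleton'.1 hb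
    rw [map_mul, Ideal.Quotient.factor_mk, Ideal.Quotient.eq_zero_iff_mem.2 haJ, mul_zero]
  · exact Ideal.Quotient.lift_surjective_of_surjective _ _ (Ideal.Quotient.factor_surjective hle)

variable [IsLocalRing R] [IsNoetherianRing R]

lemma ringKrullDim_quotient_le_sup_span_singleton (J : Ideal R) {x : R}
    (hx : x ∈ maximalIdeal R) :
    ringKrullDim (R ⧸ J) ≤ ringKrullDim (R ⧸ (J ⊔ Ideal.span {x})) + 1 := by
  rw [← Module.supportDim_quotient_eq_ringKrullDim, ← Module.supportDim_quotient_eq_ringKrullDim,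
    ← Module.supportDim_eq_of_equiv (quotSMulTopQuotientEquiv J x)]
  exact Module.supportDim_le_supportDim_quotSMulTop_succ hx

lemma ringKrullDim_quotient_le_sup_ofList (J : Ideal R) {xs : List R}
    (hxs : ∀ x ∈ xs, x ∈ maximalIdeal R) :
    ringKrullDim (R ⧸ J) ≤ ringKrullDim (R ⧸ (J ⊔ Ideal.ofList xs)) + xs.length := by
  induction xs generalizing J with
  | nil => simpa using ringKrullDim_quotient_anti (R := R) (by simp)
  | cons x xs ih =>
    rw [List.forall_mem_cons] at hxs
    refine (ringKrullDim_quotient_le_sup_span_singleton J hxs.1).trans ?_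
    grw [ih _ hxs.2]
    rw [Ideal.ofList_cons, sup_assoc, List.length_cons]
    push_cast
    rw [add_assoc]

-- An inequality rather than an equality, since J = ⊤ is allowed and then the dimension is `⊥`.
omit [IsNoetherianRing R] in
lemma ringKrullDim_quotient_nonpos {J : Ideal R} (hJ : maximalIdeal R ≤ J.radical) :
    ringKrullDim (R ⧸ J) ≤ 0 := by
  have : Ring.KrullDimLE 0 (R ⧸ J) := by
    refine Ring.krullDimLE_zero_iff.2 fun Q hQ ↦ ?_
    have hc : maximalIdeal R = Q.comap (Ideal.Quotient.mk J) := by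
      refine (maximalIdeal.isMaximal R).eq_of_le (Ideal.IsPrime.ne_top inferInstance)
        (hJ.trans ((Ideal.IsPrime.radical_le_iff inferInstance).2 fun a ha ↦ ?_))
      rw [Ideal.mem_comap, Ideal.Quotient.eq_zero_iff_mem.2 ha]
      exact Q.zero_mem
    have : (Q.comap (Ideal.Quotient.mk J)).IsMaximal := hc ▸ maximalIdeal.isMaximal R
    have h := Ideal.map_eq_top_or_isMaximal_of_surjective _ (Ideal.Quotient.mk_surjective (I := J))
      this
    rw [Ideal.map_comap_of_surjective _ Ideal.Quotient.mk_surjective] at h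
    exact h.resolve_left hQ.ne_top
  exact Order.krullDimLE_iff _ _ |>.1 this

omit [IsNoetherianRing R] in
lemma ringKrullDim_quotient_maximalIdeal : ringKrullDim (R ⧸ maximalIdeal R) = 0 := by
  have : IsField (R ⧸ maximalIdeal R) := (Ideal.Quotient.field (maximalIdeal R)).toIsField
  exact ringKrullDim_eq_zero_of_isField this

omit [IsNoetherianRing R] in
lemma maximalIdeal_le_radical_of_ringKrullDim_nonpos {J : Ideal R}
    (hJ : ringKrullDim (R ⧸ J) ≤ 0) : maximalIdeal R ≤ J.radical := by
  rw [Ideal.radical_eq_sInf]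
  refine le_sInf fun p ⟨hp, hpp⟩ ↦ ?_
  by_contra hmp
  have hpm : p < maximalIdeal R := lt_of_le_not_ge (le_maximalIdeal hpp.ne_top) hmp
  have h := ringKrullDim_quotient_succ_le_of_lt hpm
  rw [ringKrullDim_quotient_maximalIdeal, zero_add] at h
  exact absurd (h.trans ((ringKrullDim_quotient_anti hp).trans hJ)) (by norm_num)

lemma exists_isPrime_ringKrullDim_quotient_le {J : Ideal R} (hJ : J ≠ ⊤) :
    ∃ Q : Ideal R, Q.IsPrime ∧ J ≤ Q ∧ ringKrullDim (R ⧸ J) ≤ ringKrullDim (R ⧸ Q) := by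
  have : Nontrivial (R ⧸ J) := Ideal.Quotient.nontrivial_iff.2 hJ
  have : Nonempty (PrimeSpectrum.zeroLocus (J : Set R)) := by
    obtain ⟨Q, hQ, hJQ⟩ := Ideal.exists_le_maximal J hJ
    exact ⟨⟨⟨Q, hQ.isPrime⟩, hJQ⟩⟩
  simp_rw [ringKrullDim_quotient]
  have : FiniteDimensionalOrder (PrimeSpectrum.zeroLocus (J : Set R)) := by
    have := IsLocalRing.of_surjective' (Ideal.Quotient.mk J) Ideal.Quotient.mk_surjective
    rw [Order.finiteDimensionalOrder_iff_krullDim_ne_bot_and_top, ← ringKrullDim_quotient]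
    exact ⟨ringKrullDim_ne_bot, ringKrullDim_ne_top⟩
  -- The bottom of a longest chain of primes above J serves as Q.
  let p := LTSeries.longestOf (PrimeSpectrum.zeroLocus (J : Set R))
  refine ⟨p.head.1.asIdeal, p.head.1.2, p.head.2, ?_⟩
  rw [Order.krullDim_eq_length_of_finiteDimensionalOrder]
  let p' : LTSeries (PrimeSpectrum.zeroLocus (p.head.1.asIdeal : Set R)) :=
    { length := p.length
      toFun i := ⟨(p i).1, p.head_le i⟩
      step i := p.step i }
  exact Order.LTSeries.length_le_krullDim p'

/-- Each generator lowers the dimension by at most one, so each must lower it by exactly one. By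
induction I + (x) is prime; a prime Q ≥ I of full dimension omits x and lies in I + (x), hence
equals I by Nakayama. -/
theorem primeChain_of_le_ringKrullDim {I : Ideal R} {xs : List R}
    (hm : I ⊔ Ideal.ofList xs = maximalIdeal R)
    (hdim : (xs.length : WithBot ℕ∞) ≤ ringKrullDim (R ⧸ I)) : PrimeChain I xs := by
  induction xs generalizing I with
  | nil => rwa [Ideal.ofList_nil, sup_bot_eq] at hm
  | cons x xs ih =>
    rw [Ideal.ofList_cons, ← sup_assoc] at hm
    have hIm : I ⊔ Ideal.span {x} ≤ maximalIdeal R := hm ▸ le_sup_left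
    have hx : x ∈ maximalIdeal R :=
      hIm (Ideal.mem_sup_right (Ideal.mem_span_singleton_self x))
    have hxs : ∀ y ∈ xs, y ∈ maximalIdeal R := fun y hy ↦
      hm ▸ Ideal.mem_sup_right (Ideal.subset_span hy)
    have hdim' : (xs.length : WithBot ℕ∞) ≤ ringKrullDim (R ⧸ (I ⊔ Ideal.span {x})) :=
      WithBot.natCast_le_of_add_le_add (n := 1)
        (hdim.trans (ringKrullDim_quotient_le_sup_span_singleton I hx))
    have hI' := ih hm hdim'
    have := hI'.isPrime
    have hle : ringKrullDim (R ⧸ (I ⊔ Ideal.span {x})) ≤ xs.length := by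
      refine (ringKrullDim_quotient_le_sup_ofList _ hxs).trans ?_
      rw [hm, ringKrullDim_quotient_maximalIdeal, zero_add]
    have hlt : ¬ ((xs.length + 1 : ℕ) : WithBot ℕ∞) ≤ xs.length := by
      norm_cast; omega
    obtain ⟨Q, hQ, hIQ, hdQ⟩ := exists_isPrime_ringKrullDim_quotient_le (J := I) fun h ↦
      (maximalIdeal.isMaximal R).ne_top (top_le_iff.1 (h ▸ le_sup_left.trans hIm))
    have hdQ := hdim.trans hdQ
    have hxQ : x ∉ Q := fun hxQ ↦ hlt <| hdQ.trans <| (ringKrullDim_quotient_anti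
      (sup_le hIQ ((Ideal.span_singleton_le_iff_mem _).2 hxQ))).trans hle
    have hQI' : Q ≤ I ⊔ Ideal.span {x} := by
      by_contra hQI
      -- Otherwise Q + (x) strictly contains the prime I + (x), so R/(Q + (x)) loses a further
      -- dimension and dim R/Q becomes too small.
      have hlt' : I ⊔ Ideal.span {x} < Q ⊔ Ideal.span {x} :=
        lt_of_le_not_ge (sup_le_sup_right hIQ _) fun h ↦ hQI (le_sup_left.trans h)
      exact hlt <| hdQ.trans <| (ringKrullDim_quotient_le_sup_span_singleton Q hx).trans <|
        (ringKrullDim_quotient_succ_le_of_lt hlt').trans hle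
    obtain rfl : I = Q := le_antisymm hIQ (le_of_le_sup_span_singleton hIQ hx hxQ hQI')
    exact ⟨hQ, hxQ, hI'⟩

end dimension

/-! ### Independence of the system of parameters -/

section exchange

variable {R : Type*} [CommRing R]

/-- On M/(zs)M some power of z acts as a multiple of w, so whatever w kills is killed by a regular
element. -/
lemma RingTheory.Sequence.IsWeaklyRegular.exchange_last {M : Type*} [AddCommGroup M] [Module R M]
    {zs : List R} {z w : R} (h : IsWeaklyRegular M (zs ++ [z]))
    (hz : z ∈ (Module.annihilator R M ⊔ Ideal.ofList zs ⊔ Ideal.span {w}).radical) :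
    IsWeaklyRegular M (zs ++ [w]) := by
  rw [isWeaklyRegular_append_iff, isWeaklyRegular_singleton_iff] at h ⊢
  refine ⟨h.1, isSMulRegular_iff_right_eq_zero_of_smul.2 fun m hm ↦ ?_⟩
  obtain ⟨k, hk⟩ := hz
  obtain ⟨a, ha, b, hb, hab⟩ := Submodule.mem_sup.1 hk
  obtain ⟨b, rfl⟩ := Ideal.mem_span_singleton'.1 hb
  have ha' : a ∈ Module.annihilator R (M ⧸ (Ideal.ofList zs • ⊤ : Submodule R M)) := by
    refine (sup_le (LinearMap.annihilator_le_of_surjective _ (Submodule.mkQ_surjective _))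
      fun c hc ↦ Module.mem_annihilator.2 fun m ↦ ?_ :
      Module.annihilator R M ⊔ Ideal.ofList zs ≤ _) ha
    obtain ⟨m, rfl⟩ := Submodule.mkQ_surjective _ m
    rw [← map_smul]
    exact (Submodule.Quotient.mk_eq_zero _).2 (Submodule.smul_mem_smul hc trivial)
  refine isSMulRegular_iff_right_eq_zero_of_smul.1 (h.2.pow k) m ?_
  rw [← hab, add_smul, mul_smul, hm, smul_zero, add_zero]
  exact Module.mem_annihilator.1 ha' m

variable [IsLocalRing R] [IsNoetherianRing R]

omit [IsNoetherianRing R] in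
lemma not_maximalIdeal_le_of_mem_minimalPrimes {J Q : Ideal R} (hQ : Q ∈ J.minimalPrimes)
    (hdim : 1 ≤ ringKrullDim (R ⧸ J)) : ¬ maximalIdeal R ≤ Q := by
  intro hle
  have hJ : maximalIdeal R ≤ J.radical := by
    rw [Ideal.radical_eq_sInf]
    refine le_sInf fun p hp ↦ hle.trans (hQ.2 ⟨hp.2, hp.1⟩ ?_)
    exact (le_maximalIdeal hp.2.ne_top).trans hle
  exact absurd (hdim.trans (ringKrullDim_quotient_nonpos hJ)) (by norm_num)

omit [IsNoetherianRing R] in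
lemma maximalIdeal_le_radical_of_forall_notMem_minimalPrimes {J : Ideal R}
    (hdim : ringKrullDim (R ⧸ J) ≤ 1) {w : R} (hw : ∀ Q ∈ J.minimalPrimes, w ∉ Q) :
    maximalIdeal R ≤ (J ⊔ Ideal.span {w}).radical := by
  rw [Ideal.radical_eq_sInf]
  refine le_sInf fun p ⟨hp, hpp⟩ ↦ ?_
  obtain ⟨Q, hQ, hQp⟩ := Ideal.exists_minimalPrimes_le (le_sup_left.trans hp)
  have := hQ.1.1
  have hlt : Q < p := lt_of_le_not_ge hQp fun h ↦
    hw Q hQ (h (hp (Ideal.mem_sup_right (Ideal.mem_span_singleton_self w))))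
  by_contra hmp
  have hpm : p < maximalIdeal R := lt_of_le_not_ge (le_maximalIdeal hpp.ne_top) hmp
  have h₁ := ringKrullDim_quotient_succ_le_of_lt hpm
  rw [ringKrullDim_quotient_maximalIdeal, zero_add] at h₁
  have h₂ := (ringKrullDim_quotient_succ_le_of_lt hlt).trans
    ((ringKrullDim_quotient_anti hQ.1.2).trans hdim)
  grw [← h₁] at h₂
  exact absurd h₂ (by decide)

/-- Exchange through a common parameter w: replace z by w, permute w to the front, pass to R/(I +
(w)) and induct on the tails, then replace w by y. Permutation is allowed in a Noetherian local
ring. -/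
theorem isWeaklyRegular_quotient_of_isWeaklyRegular (n : ℕ) {I : Ideal R} {zs ys : List R}
    (hzm : ∀ z ∈ zs, z ∈ maximalIdeal R) (hym : ∀ y ∈ ys, y ∈ maximalIdeal R)
    (hzn : zs.length = n) (hyn : ys.length = n) (hn : (n : WithBot ℕ∞) ≤ ringKrullDim (R ⧸ I))
    (hz : maximalIdeal R ≤ (I ⊔ Ideal.ofList zs).radical)
    (hy : maximalIdeal R ≤ (I ⊔ Ideal.ofList ys).radical)
    (hreg : IsWeaklyRegular (R ⧸ I) zs) : IsWeaklyRegular (R ⧸ I) ys := by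
  induction n generalizing I zs ys with
  | zero =>
    rw [List.length_eq_zero_iff.1 hyn]
    exact IsWeaklyRegular.nil _ _
  | succ n ih =>
    obtain ⟨z, zs, rfl⟩ := List.exists_cons_of_length_eq_add_one hzn
    obtain ⟨y, ys, rfl⟩ := List.exists_cons_of_length_eq_add_one hyn
    rw [List.forall_mem_cons] at hzm hym
    rw [List.length_cons, add_left_inj] at hzn hyn
    have hdim {x : R} {xs : List R} (hx : x ∈ maximalIdeal R)
        (hxs : ∀ x ∈ xs, x ∈ maximalIdeal R) (hxn : xs.length = n)
        (hr : maximalIdeal R ≤ (I ⊔ Ideal.ofList (x :: xs)).radical) :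
        1 ≤ ringKrullDim (R ⧸ (I ⊔ Ideal.ofList xs)) ∧
          ringKrullDim (R ⧸ (I ⊔ Ideal.ofList xs)) ≤ 1 := by
      constructor
      · refine WithBot.natCast_le_of_add_le_add (m := 1) (n := n) ?_
        rw [add_comm 1 n, ← hxn]
        exact (hxn ▸ hn).trans (ringKrullDim_quotient_le_sup_ofList I hxs)
      · refine (ringKrullDim_quotient_le_sup_span_singleton _ hx).trans ?_
        rw [sup_assoc, sup_comm (Ideal.ofList xs), ← Ideal.ofList_cons]
        grw [ringKrullDim_quotient_nonpos hr]
        simp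
    have hdz := hdim hzm.1 hzm.2 hzn hz
    have hdy := hdim hym.1 hym.2 hyn hy
    -- Both tails leave one-dimensional quotients, so 𝔪 is not a minimal prime of either; prime
    -- avoidance gives w completing both tails to systems of parameters.
    obtain ⟨w, hwm, hwz, hwy⟩ : ∃ w ∈ maximalIdeal R,
        (∀ Q ∈ (I ⊔ Ideal.ofList zs).minimalPrimes, w ∉ Q) ∧
        ∀ Q ∈ (I ⊔ Ideal.ofList ys).minimalPrimes, w ∉ Q := by
      by_contra! hcon
      let S := (I ⊔ Ideal.ofList zs).minimalPrimes ∪ (I ⊔ Ideal.ofList ys).minimalPrimes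
      have hS : S.Finite :=
        (Ideal.finite_minimalPrimes_of_isNoetherianRing R _).union
          (Ideal.finite_minimalPrimes_of_isNoetherianRing R _)
      have hprime (Q : Ideal R) (hQ : Q ∈ S) : Q.IsPrime :=
        hQ.elim (fun h ↦ h.1.1) (fun h ↦ h.1.1)
      obtain ⟨Q, hQ, hle⟩ := ((maximalIdeal R).subset_union_prime_finite hS (f := id) ⊥ ⊥
        fun Q hQ _ _ ↦ hprime Q hQ).1 fun w hw ↦ by
          by_cases hwz : ∀ Q ∈ (I ⊔ Ideal.ofList zs).minimalPrimes, w ∉ Q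
          · obtain ⟨Q, hQ, hwQ⟩ := hcon w hw hwz
            exact Set.mem_biUnion (Or.inr hQ) hwQ
          · push Not at hwz
            obtain ⟨Q, hQ, hwQ⟩ := hwz
            exact Set.mem_biUnion (Or.inl hQ) hwQ
      exact hQ.elim (fun h ↦ not_maximalIdeal_le_of_mem_minimalPrimes h hdz.1 hle)
        (fun h ↦ not_maximalIdeal_le_of_mem_minimalPrimes h hdy.1 hle)
    have hrz := maximalIdeal_le_radical_of_forall_notMem_minimalPrimes hdz.2 hwz
    have hry := maximalIdeal_le_radical_of_forall_notMem_minimalPrimes hdy.2 hwy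
    have hmem {x : R} {xs : List R} (hx : x ∈ maximalIdeal R)
        (hxs : ∀ x ∈ xs, x ∈ maximalIdeal R) :
        ∀ x' ∈ xs ++ [x], x' ∈ maximalIdeal R := by
      simpa [or_imp, forall_and] using ⟨hxs, hx⟩
    have hperm (x : R) (xs : List R) : (xs ++ [x]).Perm (x :: xs) := List.perm_append_singleton x xs
    have hwzs : IsWeaklyRegular (R ⧸ I) (w :: zs) := by
      refine isWeaklyRegular_of_perm_of_subset_maximalIdeal (IsWeaklyRegular.exchange_last
        (isWeaklyRegular_of_perm_of_subset_maximalIdeal hreg (hperm z zs).symm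
          (List.forall_mem_cons.2 hzm)) ?_) (hperm w zs) (hmem hwm hzm.2)
      rw [Ideal.annihilator_quotient]
      exact hrz hzm.1
    let e := quotSMulTopQuotientEquiv I w
    rw [isWeaklyRegular_cons_iff, e.isWeaklyRegular_congr] at hwzs
    have hwys : IsWeaklyRegular (R ⧸ I) (w :: ys) := by
      rw [isWeaklyRegular_cons_iff, e.isWeaklyRegular_congr]
      refine ⟨hwzs.1, ih hzm.2 hym.2 hzn hyn ?_ ?_ ?_ hwzs.2⟩
      · exact WithBot.natCast_le_of_add_le_add (n := 1)
          (hn.trans (ringKrullDim_quotient_le_sup_span_singleton I hwm))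
      · rwa [sup_right_comm]
      · rwa [sup_right_comm]
    refine isWeaklyRegular_of_perm_of_subset_maximalIdeal (IsWeaklyRegular.exchange_last
      (isWeaklyRegular_of_perm_of_subset_maximalIdeal hwys (hperm w ys).symm
        (List.forall_mem_cons.2 ⟨hwm, hym.2⟩)) ?_) (hperm y ys) (hmem hym.1 hym.2)
    rw [Ideal.annihilator_quotient, sup_assoc, sup_comm (Ideal.ofList ys), ← Ideal.ofList_cons]
    exact hy hwm

end exchange

/-! ### Bracket powers as extensions along Frobenius -/

section bracketPower

variable {A B : Type*} [CommRing A] [CommRing B]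

lemma Ideal.bracketPower_eq_map (p e : ℕ) [ExpChar A p] (I : Ideal A) :
    I.bracketPower (p ^ e) = I.map (iterateFrobenius A p e) := rfl

lemma Ideal.bracketPower_sup (p e : ℕ) [ExpChar A p] (I J : Ideal A) :
    (I ⊔ J).bracketPower (p ^ e) = I.bracketPower (p ^ e) ⊔ J.bracketPower (p ^ e) := by
  simp_rw [Ideal.bracketPower_eq_map, Ideal.map_sup]

lemma Ideal.bracketPower_ofList (p e : ℕ) [ExpChar A p] (xs : List A) :
    (Ideal.ofList xs).bracketPower (p ^ e) = Ideal.ofList (xs.map (· ^ p ^ e)) := by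
  rw [Ideal.bracketPower_eq_map, Ideal.map_ofList]
  rfl

lemma Ideal.map_bracketPower (p e : ℕ) [ExpChar A p] [ExpChar B p] (f : A →+* B) (I : Ideal A) :
    (I.bracketPower (p ^ e)).map f = (I.map f).bracketPower (p ^ e) := by
  simp_rw [Ideal.bracketPower_eq_map, Ideal.map_map]
  congr 1
  ext x
  simp [iterateFrobenius_def]

lemma Ideal.bracketPower_le (I : Ideal A) {q : ℕ} (hq : q ≠ 0) : I.bracketPower q ≤ I := by
  refine Ideal.span_le.2 ?_
  rintro _ ⟨x, hx, rfl⟩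
  exact Ideal.pow_mem_of_mem I hx q (Nat.pos_of_ne_zero hq)

lemma Ideal.le_radical_bracketPower (I : Ideal A) (q : ℕ) : I ≤ (I.bracketPower q).radical :=
  fun x hx ↦ ⟨q, Ideal.subset_span ⟨x, hx, rfl⟩⟩

end bracketPower

/-! ### Depth and the Cohen–Macaulay criterion -/

section depth

variable {R : Type*} [CommRing R] [IsLocalRing R]

lemma le_localRingDepth {xs : List R} (h : IsRegular R xs) (hxs : ∀ x ∈ xs, x ∈ maximalIdeal R) :
    (xs.length : ℕ∞) ≤ localRingDepth R :=
  le_iSup₂_of_le (f := fun (rs : List R) _ ↦ (rs.length : ℕ∞)) xs ⟨h, hxs⟩ le_rfl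

lemma exists_isRegular_of_le_localRingDepth {n : ℕ} (h : n ≤ localRingDepth R) :
    ∃ xs : List R, IsRegular R xs ∧ (∀ x ∈ xs, x ∈ maximalIdeal R) ∧ n ≤ xs.length := by
  by_contra! hcon
  cases n with
  | zero => exact absurd (hcon [] (IsRegular.nil R R) (by simp)) (by simp)
  | succ n =>
    have hle : localRingDepth R ≤ n := iSup₂_le fun xs hxs ↦ by
      exact_mod_cast Nat.lt_succ_iff.1 (hcon xs hxs.1 hxs.2)
    have := h.trans hle
    norm_cast at this
    omega

variable [IsNoetherianRing R]

lemma length_le_ringKrullDim_of_isRegular {xs : List R} (h : IsRegular R xs) :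
    (xs.length : WithBot ℕ∞) ≤ ringKrullDim R := by
  rw [← ringKrullDim_add_length_eq_ringKrullDim_of_isRegular xs h]
  have : Nontrivial (R ⧸ Ideal.ofList xs) := Ideal.Quotient.nontrivial_iff.2 fun h' ↦
    h.2 (by simp [h'])
  exact le_add_of_nonneg_left ringKrullDim_nonneg_of_nontrivial

lemma localRingDepth_le {n : ℕ} (h : ringKrullDim R = n) : localRingDepth R ≤ n := by
  refine iSup₂_le fun xs hxs ↦ ?_
  have := length_le_ringKrullDim_of_isRegular hxs.1
  rw [h] at this
  exact_mod_cast this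

/-- A regular sequence of length dim R/I is itself a system of parameters, so its regularity
transfers to ys; conversely ys attains the upper bound dim R/I for the depth. -/
lemma isCohenMacaulayLocalRing_quotient_iff {I : Ideal R} (hI : I ≠ ⊤) {ys : List R}
    (hym : ∀ y ∈ ys, y ∈ maximalIdeal R) (hdim : ringKrullDim (R ⧸ I) = ys.length)
    (hy : maximalIdeal R ≤ (I ⊔ Ideal.ofList ys).radical) :
    IsCohenMacaulayLocalRing (R ⧸ I) ↔ IsWeaklyRegular (R ⧸ I) ys := by
  have := Ideal.Quotient.nontrivial_iff.2 hI
  have hloc : IsLocalRing (R ⧸ I) :=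
    IsLocalRing.of_surjective' (Ideal.Quotient.mk I) Ideal.Quotient.mk_surjective
  have hmem (x : R) (hx : x ∈ maximalIdeal R) :
      Ideal.Quotient.mk I x ∈ maximalIdeal (R ⧸ I) := by
    rw [← IsLocalRing.map_maximalIdeal_of_surjective (Ideal.Quotient.mk I)
      Ideal.Quotient.mk_surjective]
    exact Ideal.mem_map_of_mem _ hx
  constructor
  · intro h
    have hd := h.depth_eq_ringKrullDim
    rw [hdim] at hd
    have hd : localRingDepth (R ⧸ I) = ys.length := by exact_mod_cast hd
    obtain ⟨zs, hzs, hzm, hlen⟩ := exists_isRegular_of_le_localRingDepth hd.ge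
    obtain ⟨zs, rfl⟩ := List.map_surjective_iff.2 Ideal.Quotient.mk_surjective zs
    have hlen' := length_le_ringKrullDim_of_isRegular hzs
    rw [hdim, List.length_map] at hlen'
    rw [List.length_map] at hlen
    have hlen : zs.length = ys.length := le_antisymm (by exact_mod_cast hlen') hlen
    have hzm' (z : R) (hz : z ∈ zs) : z ∈ maximalIdeal R := fun hu ↦
      hzm _ (List.mem_map_of_mem hz) (hu.map (Ideal.Quotient.mk I))
    refine isWeaklyRegular_quotient_of_isWeaklyRegular ys.length hzm' hym hlen rfl hdim.ge ?_ hy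
      ((isWeaklyRegular_map_algebraMap_iff (R ⧸ I) _ _).1 hzs.1)
    refine maximalIdeal_le_radical_of_ringKrullDim_nonpos ?_
    have hz := ringKrullDim_add_length_eq_ringKrullDim_of_isRegular _ hzs
    rw [hdim, List.length_map, hlen, ← Ideal.map_ofList,
      ringKrullDim_eq_of_ringEquiv (DoubleQuot.quotQuotEquivQuotSup I (Ideal.ofList zs))] at hz
    exact WithBot.nonpos_of_add_natCast_le hz.le
  · intro h
    have hreg : IsRegular (R ⧸ I) (ys.map (Ideal.Quotient.mk I)) :=
      IsRegular.of_isWeaklyRegular_of_mem_maximalIdeal _ (List.forall_mem_map.2 fun y hy ↦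
        hmem y (hym y hy)) ((isWeaklyRegular_map_algebraMap_iff (R ⧸ I) _ _).2 h)
    have hle := le_localRingDepth hreg (List.forall_mem_map.2 fun y hy ↦ hmem y (hym y hy))
    rw [List.length_map] at hle
    exact { depth_eq_ringKrullDim := by
              rw [hdim, le_antisymm (localRingDepth_le hdim) hle]
              rfl }

omit [IsLocalRing R] in
lemma exists_ofList_eq (I : Ideal R) :
    ∃ xs : List R, xs.length = I.spanFinrank ∧ Ideal.ofList xs = I := by
  obtain ⟨s, hs, hsI⟩ := Submodule.FG.exists_span_finset_card_eq_spanFinrank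
    (IsNoetherian.noetherian I)
  refine ⟨s.toList, by simp [hs], ?_⟩
  rw [← hsI]
  simp [Ideal.ofList, Ideal.span]

/-- Lift a minimal generating list of the maximal ideal of R/P; regularity says its length is the
dimension. -/
lemma exists_sup_ofList_eq_maximalIdeal (P : Ideal R) (hreg : IsRegularLocalRing (R ⧸ P)) :
    ∃ xs : List R, P ⊔ Ideal.ofList xs = maximalIdeal R ∧ ringKrullDim (R ⧸ P) = xs.length := by
  obtain ⟨xs, hlen, hxs⟩ := exists_ofList_eq (maximalIdeal (R ⧸ P))
  obtain ⟨xs, rfl⟩ := List.map_surjective_iff.2 Ideal.Quotient.mk_surjective xs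
  refine ⟨xs, ?_, ?_⟩
  · have := Ideal.comap_isMaximal_of_surjective (Ideal.Quotient.mk P)
      Ideal.Quotient.mk_surjective (K := maximalIdeal (R ⧸ P))
    rw [← IsLocalRing.eq_maximalIdeal this, ← hxs, ← Ideal.map_ofList,
      Ideal.comap_map_of_surjective _ Ideal.Quotient.mk_surjective, ← RingHom.ker_eq_comap_bot,
      Ideal.mk_ker, sup_comm]
  · rw [← hreg.spanFinrank_maximalIdeal, ← hlen, List.length_map]

end depth

/-! ### Comparison of the Hilbert–Kunz values -/

theorem hilbertKunzFunction_eq_iff {R : Type*} [CommRing R] [IsLocalRing R] [IsNoetherianRing R]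
    (p : ℕ) [Fact p.Prime] [CharP R p] (P : Ideal R) [P.IsPrime]
    (hreg : IsRegularLocalRing (R ⧸ P))
    (hdim : (P.height : WithBot ℕ∞) + ringKrullDim (R ⧸ P) = ringKrullDim R) (e : ℕ) :
    hilbertKunzFunction R (p ^ e) = hilbertKunzFunction (Localization.AtPrime P) (p ^ e) ↔
      IsCohenMacaulayLocalRing (R ⧸ P.bracketPower (p ^ e)) := by
  have hp := (Fact.out : p.Prime)
  have : ExpChar R p := .prime hp
  have hchar : CharP (Localization.AtPrime P) p := by
    rw [CharP.charP_iff_prime_eq_zero hp, ← map_natCast (algebraMap R _), CharP.cast_eq_zero,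
      map_zero]
  have : ExpChar (Localization.AtPrime P) p := .prime hp
  have hq : p ^ e ≠ 0 := pow_ne_zero _ hp.ne_zero
  obtain ⟨xs, hxs, hd⟩ := exists_sup_ofList_eq_maximalIdeal P hreg
  let ys := xs.map (· ^ p ^ e)
  have hlen : ys.length = xs.length := List.length_map _
  have hbr : (maximalIdeal R).bracketPower (p ^ e) = P.bracketPower (p ^ e) ⊔ Ideal.ofList ys := by
    rw [← hxs, Ideal.bracketPower_sup, Ideal.bracketPower_ofList]
  have hchain := primeChain_of_le_ringKrullDim hxs hd.ge
  have hym (y : R) (hy : y ∈ ys) : y ∈ maximalIdeal R :=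
    Ideal.bracketPower_le _ hq (hbr ▸ Ideal.mem_sup_right (Ideal.subset_span hy))
  have hy : maximalIdeal R ≤ (P.bracketPower (p ^ e) ⊔ Ideal.ofList ys).radical :=
    hbr ▸ Ideal.le_radical_bracketPower _ _
  have hdI : ringKrullDim (R ⧸ P.bracketPower (p ^ e)) = ys.length := by
    refine le_antisymm ?_ ?_
    · refine (ringKrullDim_quotient_le_sup_ofList _ hym).trans ?_
      grw [ringKrullDim_quotient_nonpos hy]
      rw [zero_add]
    · rw [hlen, ← hd]
      exact ringKrullDim_quotient_anti (Ideal.bracketPower_le P hq)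
  have hI : P.bracketPower (p ^ e) ≠ ⊤ := fun h ↦
    Ideal.IsPrime.ne_top ‹P.IsPrime› (top_le_iff.1 (h ▸ Ideal.bracketPower_le P hq))
  rw [isCohenMacaulayLocalRing_quotient_iff hI hym hdI hy]
  obtain ⟨hfin, hle, hiff⟩ := length_quotient_ofList_smul_top hq hchain
    (M := R ⧸ P.bracketPower (p ^ e))
    (by rw [Ideal.annihilator_quotient]; exact Ideal.le_radical_bracketPower P _)
  rw [← hiff]
  have hL := (quotSMulTopQuotientEquivSup (P.bracketPower (p ^ e)) (Ideal.ofList ys)).length_eq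
  rw [← hbr] at hL
  have hl := localLength_quotient P (P.bracketPower (p ^ e))
  rw [Ideal.map_bracketPower, Localization.AtPrime.map_eq_maximalIdeal] at hl
  rw [hL] at hfin ⊢
  rw [hl]
  have hfin' : localLength P (R ⧸ P.bracketPower (p ^ e)) ≠ ⊤ := localLength_ne_top P
    (by rw [Ideal.annihilator_quotient]; exact Ideal.le_radical_bracketPower P _)
  rw [hl] at hfin'
  obtain ⟨h, hh⟩ := ENat.ne_top_iff_exists.1 (Ideal.height_ne_top (Ideal.IsPrime.ne_top ‹P.IsPrime›))
  rw [hd, ← hh] at hdim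
  rw [hilbertKunzFunction, hilbertKunzFunction, ← hdim,
    IsLocalization.AtPrime.ringKrullDim_eq_height P, ← hh]
  -- Both lengths are finite, so `toNat` is faithful and the claim becomes a = q^d · b after
  -- cancelling q^h, with h = ht P.
  obtain ⟨a, ha⟩ := ENat.ne_top_iff_exists.1 hfin
  obtain ⟨b, hb⟩ := ENat.ne_top_iff_exists.1 hfin'
  rw [← ha, ← hb]
  have hdeg : ((((h : ℕ∞) : WithBot ℕ∞) + xs.length).unbotD 0).toNat = h + xs.length := by
    norm_cast
  have hdeg' : (((h : ℕ∞) : WithBot ℕ∞).unbotD 0).toNat = h := by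
    norm_cast
  rw [hdeg, hdeg', ENat.toNat_natCast, ENat.toNat_natCast]
  have hqR : ((p ^ e : ℕ) : ℝ) ≠ 0 := Nat.cast_ne_zero.2 hq
  rw [pow_add, div_eq_div_iff (by positivity) (by positivity), mul_comm _ (((p ^ e : ℕ) : ℝ) ^ h),
    mul_left_comm (b : ℝ), mul_right_inj' (pow_ne_zero _ hqR), mul_comm (b : ℝ)]
  norm_cast

theorem mainTheorem12 {R : Type*} [CommRing R] [IsLocalRing R] [IsNoetherianRing R]
    (p : ℕ) [Fact p.Prime] [CharP R p] (P : Ideal R) [P.IsPrime]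
    (hreg : IsRegularLocalRing (R ⧸ P))
    (hdim : (P.height : WithBot ℕ∞) + ringKrullDim (R ⧸ P) = ringKrullDim R) :
    (∀ e : ℕ,
      hilbertKunzFunction R (p ^ e) = hilbertKunzFunction (Localization.AtPrime P) (p ^ e) ↔
        IsCohenMacaulayLocalRing (R ⧸ P.bracketPower (p ^ e))) ∧
    ((∀ e : ℕ,
      hilbertKunzFunction R (p ^ e) = hilbertKunzFunction (Localization.AtPrime P) (p ^ e)) ↔
        ∀ e : ℕ, IsCohenMacaulayLocalRing (R ⧸ P.bracketPower (p ^ e))) :=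
  ⟨hilbertKunzFunction_eq_iff p P hreg hdim,
    forall_congr' (hilbertKunzFunction_eq_iff p P hreg hdim)⟩
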